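/- Let $n,g,m\ge 0$ be integers and let $A_n=\mathbb{Z}^n\subset\mathbb{R}^n$ be the free abelian group with standard basis $\bar a_1,\dots,\bar a_n$. Let $\Gamma_n$ be its Cayley graph with respect to this basis, with edges $(x,i)$ from $x$ to $x+\bar a_i$, and let $C_1(\Gamma_n)$ be the group of integral $1$-chains; for a subgroup $L\le A_n$ let $\pi_L:C_1(\Gamma_n)\to C_1(\Gamma_n/L)$ be the quotient map. Fix $\bar c_1,\dots,\bar c_m\in A_n$, $\delta\in C_1(\Gamma_n)$ and $h\in\Lambda^2(A_n)$, and consider the system $$\begin{cases}\langle \bar u_1,\bar v_1,\dots,\bar u_g,\bar v_g,\bar c_1,\dots,\bar c_m\rangle=L,\\ \pi_L(\delta)=0,\\ \bar u_1\wedge\bar v_1+\dots+\bar u_g\wedge\bar v_g= h \bmod K,\end{cases}\qquad K=\langle \bar c_i\wedge x : 1\le i\le m,\ x\in L\rangle\le\Lambda^2(A_n),$$ in the unknowns $\bar u_i,\bar v_i\in A_n$ and $L\le A_n$. Let $\|\cdot\|$ be the Euclidean norm on $A_n\subset\mathbb{R}^n$, and on $\Lambda^2(A_n)$ the Euclidean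 norm for which the elements $\bar a_i\wedge\bar a_j$ ($i<j$) are orthonormal. Put $\omega=\frac{\sqrt3}{2}$ and $D=\max_i\|\bar c_i\|+\operatorname{diam}\operatorname{supp}(\delta)$, where $\operatorname{supp}(\delta)$ is the set of edges with nonzero coefficient in $\delta$, the distance of two edges is the distance of their midpoints in $\Gamma_n$ (all edges having length $1$), and the maximum and the diameter of an empty set are $0$. Let $$B=n\,2^n\,\omega^{-\frac{n(n-1)}2}D^n+2\,\omega^{1-n}\,\|h\|\,\bigl(\max\{1,\max_i\|\bar c_i\|\}\bigr)^n .$$ If the system has a solution, then it has a solution such that $L$ has a basis $\{f_1,\dots,f_k\}$ with $\|f_i\|\le B$ for all $i$. Moreover, only finitely many subgroups $L\le A_n$ have a basis whose elements all have norm at most $B$. -/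

import Mathlib

noncomputable section

namespace ReducedSystem

/-- The free abelian group `A_n` of rank `n` (written additively), with its standard basis
`ā_1, …, ā_n`. It is canonically embedded in Euclidean space `ℝⁿ`. -/
abbrev A (n : ℕ) : Type := Fin n → ℤ

/-- The basis element `ā_i` of `A_n`. -/
def gen {n : ℕ} (i : Fin n) : A n := Pi.single i 1

/-- The Euclidean norm of an element of `A_n ⊆ ℝⁿ`. -/
def euclNorm {n : ℕ} (x : A n) : ℝ :=
  ‖(WithLp.toLp 2 (fun i => (x i : ℝ)) : EuclideanSpace ℝ (Fin n))‖

/-! ### The Cayley graph `Γ_n` of `A_n` and its 1-chains -/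

/-- The Cayley graph `Γ_n` of `A_n` with respect to the generators `ā_1, …, ā_n`. -/
def cayleyGraph (n : ℕ) : SimpleGraph (A n) :=
  SimpleGraph.addCayley (Set.range (gen : Fin n → A n))

/-- The positively oriented edges of the quotient graph `Γ_n / L`: the pair `(x, i)` is the edge
labelled `a_i` from the vertex `x` to the vertex `x + ā_i`. The inverse edge, labelled `a_i⁻¹`,
is its negative as a chain, so these edges form a basis of the group of 1-chains. -/
abbrev QuotEdge {n : ℕ} (L : Submodule ℤ (A n)) : Type := (A n ⧸ L) × Fin n

/-- The positively oriented edges of `Γ_n`; the edge `(x, i)` goes from `x` to `x + ā_i`. -/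
abbrev Edge (n : ℕ) : Type := A n × Fin n

/-- The group `C_1(Γ_n)` of integral 1-chains. -/
abbrev Chain (n : ℕ) : Type := Edge n →₀ ℤ

/-- The quotient map `π_L : C_1(Γ_n) → C_1(Γ_n / L)`. -/
def quotChain {n : ℕ} (L : Submodule ℤ (A n)) (δ : Chain n) : QuotEdge L →₀ ℤ :=
  Finsupp.mapDomain (fun e => (Submodule.Quotient.mk e.1, e.2)) δ

/-- The distance between two edges of `Γ_n`: the distance between their midpoints, where all
edges have length `1`. A path between the midpoints of two distinct edges consists of half of the
first edge, a path between an endpoint of the first and an endpoint of the second, and half of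
the second edge. -/
def edgeDist {n : ℕ} (e f : Edge n) : ℕ :=
  if e = f then 0 else
    1 + min (min ((cayleyGraph n).dist e.1 f.1)
                 ((cayleyGraph n).dist e.1 (f.1 + gen f.2)))
            (min ((cayleyGraph n).dist (e.1 + gen e.2) f.1)
                 ((cayleyGraph n).dist (e.1 + gen e.2) (f.1 + gen f.2)))

/-- The diameter of the support of a 1-chain (`0` for the zero chain). -/
def diamSupp {n : ℕ} (δ : Chain n) : ℕ :=
  (δ.support ×ˢ δ.support).sup fun p => edgeDist p.1 p.2

/-! ### The external square -/

/-- The external square `Λ²(A_n)`. -/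
abbrev Wedge (n : ℕ) : Type := ⋀[ℤ]^2 (A n)

/-- The wedge product `x ∧ y` in `Λ²(A_n)`. -/
def wedge {n : ℕ} (x y : A n) : Wedge n := exteriorPower.ιMulti ℤ 2 ![x, y]

/-- The Euclidean norm on `Λ²(A_n) ⊆ Λ²(ℝⁿ)` for which the elements `ā_i ∧ ā_j`, `i < j`,
are orthonormal. -/
def wedgeNorm {n : ℕ} (h : Wedge n) : ℝ :=
  √(∑ s : Set.powersetCard (Fin n) 2,
      ((((Pi.basisFun ℤ (Fin n)).exteriorPower 2).repr h s : ℤ) : ℝ) ^ 2)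

/-- The subgroup `K` of `Λ²(A_n)` generated by all `c̄_i ∧ x` with `x ∈ L`. -/
def subK {n m : ℕ} (c : Fin m → A n) (L : Submodule ℤ (A n)) : Submodule ℤ (Wedge n) :=
  Submodule.span ℤ {w | ∃ i, ∃ x ∈ L, w = wedge (c i) x}

/-! ### The reduced system and the bound -/

/-- `(u, v)` together with the subgroup `L` of `A_n` is a solution of the reduced system
* `⟨ū_1, v̄_1, …, ū_g, v̄_g, c̄_1, …, c̄_m⟩ = L`,
* `π_L(δ) = 0`,
* `ū_1 ∧ v̄_1 + ⋯ + ū_g ∧ v̄_g = h mod K`. -/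
structure IsSolution {n g m : ℕ} (c : Fin m → A n) (δ : Chain n) (h : Wedge n)
    (u v : Fin g → A n) (L : Submodule ℤ (A n)) : Prop where
  span_eq : Submodule.span ℤ (Set.range u ∪ Set.range v ∪ Set.range c) = L
  chain_eq : quotChain L δ = 0
  wedge_eq : (Submodule.Quotient.mk (∑ i, wedge (u i) (v i)) : Wedge n ⧸ subK c L) =
    Submodule.Quotient.mk h

/-- The constant `ω = √3 / 2`. -/
def ω : ℝ := √3 / 2

/-- `max_i ‖c̄_i‖`, which is `0` if there are no `c̄_i`. -/
def maxNorm {n m : ℕ} (c : Fin m → A n) : ℝ := ⨆ i, euclNorm (c i)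

/-- `D = max_i ‖c̄_i‖ + diam supp(δ)`. -/
def constD {n m : ℕ} (c : Fin m → A n) (δ : Chain n) : ℝ := maxNorm c + diamSupp δ

/-- The bound
`n 2ⁿ ω^{-n(n-1)/2} Dⁿ + 2 ω^{1-n} ‖h‖ (max {1, max_i ‖c̄_i‖})ⁿ`.
As nonzero elements of `A_n` have norm at least `1`, the outer maximum with `1` matters only
when all `c̄_i` are zero. -/
def basisBound {n m : ℕ} (c : Fin m → A n) (δ : Chain n) (h : Wedge n) : ℝ :=
  n * 2 ^ n * ω ^ (-((n : ℤ) * (n - 1) / 2)) * constD c δ ^ n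
    + 2 * ω ^ (1 - (n : ℤ)) * wedgeNorm h * (max 1 (maxNorm c)) ^ n

/-- The subgroup `L` has a (free abelian) basis whose elements have norm at most `B`. -/
def HasBasisBoundedBy {n : ℕ} (L : Submodule ℤ (A n)) (B : ℝ) : Prop :=
  ∃ (k : ℕ) (f : Module.Basis (Fin k) ℤ L), ∀ i, euclNorm (f i : A n) ≤ B

end ReducedSystem

end

/-! A solution can be pushed forward along any endomorphism `p` of `L` that fixes a finite set of
short elements: the `c i`, the columns of the skew-symmetric matrix of `h`, and the elements of `L`
that translate one edge of the support of `δ` to another with the same label. All have norm at most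
R = max(D, ‖h‖). The columns are what makes the wedge equation survive. Since h = ∑ u∧v + ∑ c∧x with
all factors in `L`, its columns lie in `L`, and if `p` fixes them then applying `p` to every factor
leaves `h` unchanged (`sum_wedge_map_eq`, `IsSolution.map`). Choose `p` to be a retraction of `L`
onto the elements having a nonzero multiple in the span of the short elements (`exists_retraction`).
Its image is commensurable with that span, so size reduction gives a basis of norm at most (k + 1)/2
· R, with k ≤ n the rank (`exists_bounded_basis`). The required bound is weaker than this
(`mul_max_le_basisBound`). -/

namespace ReducedSystem

/-! ### Retractions and functionals on finitely generated abelian groups -/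

section Modules

universe u

variable {M : Type u} [AddCommGroup M] [Module.Finite ℤ M]

/-- Every submodule `W` of a finitely generated abelian group lies in the kernel of a surjection
onto a free group, with every element of the kernel having a nonzero multiple in `W`. -/
lemma exists_free_quotient (W : Submodule ℤ M) :
    ∃ (F : Type u) (_ : AddCommGroup F) (_ : Module.Finite ℤ F) (_ : Module.Free ℤ F)
      (π : M →ₗ[ℤ] F), Function.Surjective π ∧ (∀ x ∈ W, π x = 0) ∧
        ∀ x, π x = 0 → ∃ a : ℤ, a ≠ 0 ∧ a • x ∈ W := by
  -- Finitely generated and torsion-free over ℤ, hence free.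
  refine ⟨(M ⧸ W) ⧸ Submodule.torsion ℤ (M ⧸ W), inferInstance, inferInstance, inferInstance,
    (Submodule.mkQ _).comp W.mkQ, ?_, ?_, ?_⟩
  · exact (Submodule.mkQ_surjective _).comp (Submodule.mkQ_surjective _)
  · intro x hx
    have : W.mkQ x = 0 := by simpa using hx
    rw [LinearMap.comp_apply, this, map_zero]
  · intro x hx
    have h1 : W.mkQ x ∈ Submodule.torsion ℤ (M ⧸ W) := by simpa using hx
    obtain ⟨a, ha⟩ := (Submodule.mem_torsion_iff _).1 h1
    refine ⟨a, nonZeroDivisors.coe_ne_zero a, ?_⟩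
    have h2 : W.mkQ ((a : ℤ) • x) = 0 := by
      rw [map_smul]; exact ha
    exact (Submodule.Quotient.mk_eq_zero W).1 h2

/-- A finitely generated abelian group has an endomorphism fixing a given set, all of whose values
have a nonzero multiple in the span of this set. -/
lemma exists_retraction (S : Set M) :
    ∃ p : M →ₗ[ℤ] M, (∀ x ∈ S, p x = x) ∧
      ∀ x, ∃ a : ℤ, a ≠ 0 ∧ a • p x ∈ Submodule.span ℤ S := by
  obtain ⟨F, _, _, _, π, hsurj, hW, hker⟩ := exists_free_quotient (Submodule.span ℤ S)
  obtain ⟨s, hs⟩ := π.exists_rightInverse_of_surjective (LinearMap.range_eq_top.2 hsurj)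
  -- As π ∘ s = id, the values of id − s ∘ π lie in ker π; on ker π this map is the identity.
  refine ⟨LinearMap.id - s.comp π, fun x hx => ?_, fun x => hker _ ?_⟩
  · simp [hW x (Submodule.subset_span hx)]
  · have := LinearMap.congr_fun hs (π x)
    simp only [LinearMap.comp_apply, LinearMap.id_apply] at this
    simp [this]

/-- An element without nonzero multiples in a subgroup is detected by an integral functional
vanishing on the subgroup. -/
lemma exists_functional_ne_zero (W : Submodule ℤ M) (v : M) (hv : ∀ a : ℤ, a ≠ 0 → a • v ∉ W) :
    ∃ l : M →ₗ[ℤ] ℤ, (∀ w ∈ W, l w = 0) ∧ l v ≠ 0 := by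
  obtain ⟨F, _, _, _, π, -, hW, hker⟩ := exists_free_quotient W
  have hne : π v ≠ 0 := fun h0 => by
    obtain ⟨a, ha, haW⟩ := hker v h0
    exact hv a ha haW
  have : ¬ ∀ f : Module.Dual ℤ F, f (π v) = 0 := fun h0 =>
    hne ((Module.forall_dual_apply_eq_zero_iff ℤ (π v)).1 h0)
  push Not at this
  obtain ⟨f, hf⟩ := this
  exact ⟨f.comp π, fun w hw => by simp [hW w hw], hf⟩

end Modules

/-! ### The Euclidean norm and finiteness of balls -/

section Norm

variable {n : ℕ}

/-- The embedding of `A_n` into Euclidean space. -/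
def toEuclidean (n : ℕ) : A n →+ EuclideanSpace ℝ (Fin n) where
  toFun x := WithLp.toLp 2 (fun i => (x i : ℝ))
  map_zero' := by ext; simp
  map_add' x y := by ext; simp

lemma euclNorm_eq (x : A n) : euclNorm x = ‖toEuclidean n x‖ := rfl

lemma euclNorm_nonneg (x : A n) : 0 ≤ euclNorm x := norm_nonneg _

lemma euclNorm_add_le (x y : A n) : euclNorm (x + y) ≤ euclNorm x + euclNorm y := by
  simp only [euclNorm_eq, map_add]; exact norm_add_le _ _

lemma euclNorm_sub_le (x y : A n) : euclNorm (x - y) ≤ euclNorm x + euclNorm y := by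
  simp only [euclNorm_eq, map_sub]; exact norm_sub_le _ _

lemma euclNorm_sub_comm (x y : A n) : euclNorm (x - y) = euclNorm (y - x) := by
  simp only [euclNorm_eq, map_sub]; exact norm_sub_rev _ _

lemma euclNorm_zsmul (a : ℤ) (x : A n) : euclNorm (a • x) = |(a : ℝ)| * euclNorm x := by
  rw [euclNorm_eq, map_zsmul, euclNorm_eq, ← Int.cast_smul_eq_zsmul ℝ, norm_smul,
    Real.norm_eq_abs]

lemma euclNorm_sum_le {ι : Type*} (s : Finset ι) (f : ι → A n) :
    euclNorm (∑ i ∈ s, f i) ≤ ∑ i ∈ s, euclNorm (f i) := by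
  simp only [euclNorm_eq, map_sum]; exact norm_sum_le _ _

lemma euclNorm_sq (x : A n) : euclNorm x ^ 2 = ∑ i, (x i : ℝ) ^ 2 := by
  rw [euclNorm_eq, EuclideanSpace.norm_sq_eq]
  simp [toEuclidean]

@[simp] lemma euclNorm_zero : euclNorm (0 : A n) = 0 := by simp [euclNorm_eq]

lemma abs_apply_le_euclNorm (x : A n) (i : Fin n) : |(x i : ℝ)| ≤ euclNorm x := by
  refine abs_le_of_sq_le_sq ?_ (euclNorm_nonneg x)
  rw [euclNorm_sq]
  exact Finset.single_le_sum (f := fun i => (x i : ℝ) ^ 2) (fun _ _ => sq_nonneg _)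
    (Finset.mem_univ i)

lemma one_le_euclNorm {x : A n} (hx : x ≠ 0) : 1 ≤ euclNorm x := by
  obtain ⟨i, hi⟩ := Function.ne_iff.1 hx
  refine le_trans ?_ (abs_apply_le_euclNorm x i)
  exact_mod_cast Int.one_le_abs hi

lemma euclNorm_gen (i : Fin n) : euclNorm (gen i) = 1 := by
  have h : euclNorm (gen i) ^ 2 = 1 := by
    rw [euclNorm_sq, Finset.sum_eq_single i]
    · simp [gen]
    · intro j _ hj
      simp [gen, hj]
    · simp
  exact (pow_eq_one_iff_of_nonneg (euclNorm_nonneg _) two_ne_zero).1 h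

lemma finite_ball (n : ℕ) (B : ℝ) : {x : A n | euclNorm x ≤ B}.Finite := by
  refine (Set.Finite.pi' (t := fun _ : Fin n => Set.Icc (-⌊B⌋) ⌊B⌋)
    (fun _ => Set.finite_Icc _ _)).subset fun x hx i => ?_
  have h := abs_le.1 ((abs_apply_le_euclNorm x i).trans hx)
  have h1 : x i ≤ ⌊B⌋ := Int.le_floor.2 h.2
  have h2 : - x i ≤ ⌊B⌋ := Int.le_floor.2 (by push_cast; linarith [h.1])
  exact ⟨by linarith, h1⟩

lemma finite_hasBasisBoundedBy (n : ℕ) (B : ℝ) :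
    {L : Submodule ℤ (A n) | HasBasisBoundedBy L B}.Finite := by
  refine ((finite_ball n B).finite_subsets.image (Submodule.span ℤ)).subset ?_
  rintro L ⟨k, f, hf⟩
  refine ⟨Set.range fun i => (f i : A n), ?_, ?_⟩
  · rintro _ ⟨i, rfl⟩
    exact hf i
  · have h := congrArg (Submodule.map L.subtype) f.span_eq
    rw [Submodule.map_span, Submodule.map_top, Submodule.range_subtype, ← Set.range_comp] at h
    exact h

end Norm

/-! ### Bases of short vectors by size reduction -/

section ReducedBasis

variable {n : ℕ}

/-- Size reduction: if a nonzero multiple `a • y` differs from a bounded multiple of `v` by a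
combination of the `w j`, then `y` may be shortened by integral multiples of the `w j`. -/
lemma exists_size_reduction {k : ℕ} (w : Fin k → A n) (y v : A n) (a b : ℤ) (q : Fin k → ℤ)
    (R : ℝ) (ha : a ≠ 0) (hab : |b| ≤ |a|) (hy : a • y = b • v + ∑ j, q j • w j)
    (hv : euclNorm v ≤ R) (hw : ∀ j, euclNorm (w j) ≤ R) :
    ∃ z ∈ Submodule.span ℤ (Set.range w), euclNorm (y - z) ≤ (k + 2) / 2 * R := by
  set r : Fin k → ℤ := fun j => round ((q j : ℝ) / a) with hr
  have ha' : (a : ℝ) ≠ 0 := by exact_mod_cast ha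
  have hpos : 0 < |(a : ℝ)| := abs_pos.2 ha'
  have hR : 0 ≤ R := (euclNorm_nonneg v).trans hv
  refine ⟨∑ j, r j • w j, Submodule.sum_mem _ fun j _ => Submodule.smul_mem _ _
    (Submodule.subset_span ⟨j, rfl⟩), ?_⟩
  -- Rounding leaves remainders of at most |a|/2. After division by |a|, `v` contributes at most R
  -- and each `w j` at most R/2.
  have hrem (j : Fin k) : |((q j - a * r j : ℤ) : ℝ)| ≤ |(a : ℝ)| / 2 := by
    have h1 : ((q j - a * r j : ℤ) : ℝ) = a * ((q j : ℝ) / a - r j) := by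
      push_cast; field_simp
    rw [h1, abs_mul]
    have := abs_sub_round ((q j : ℝ) / a)
    nlinarith
  have hexp : a • (y - ∑ j, r j • w j) = b • v + ∑ j, (q j - a * r j) • w j := by
    simp only [smul_sub, hy, Finset.smul_sum, sub_smul, Finset.sum_sub_distrib, mul_smul]
    abel
  have hmul : |(a : ℝ)| * euclNorm (y - ∑ j, r j • w j) ≤ |(a : ℝ)| * ((k + 2) / 2 * R) := by
    rw [← euclNorm_zsmul, hexp]
    calc euclNorm (b • v + ∑ j, (q j - a * r j) • w j)
        ≤ euclNorm (b • v) + ∑ j, euclNorm ((q j - a * r j) • w j) :=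
          (euclNorm_add_le _ _).trans (by gcongr; exact euclNorm_sum_le _ _)
      _ ≤ |(a : ℝ)| * R + ∑ _j : Fin k, |(a : ℝ)| / 2 * R := by
          refine add_le_add ?_ (Finset.sum_le_sum fun j _ => ?_)
          · rw [euclNorm_zsmul]
            refine mul_le_mul ?_ hv (euclNorm_nonneg _) hpos.le
            exact_mod_cast hab
          · rw [euclNorm_zsmul]
            exact mul_le_mul (hrem j) (hw j) (euclNorm_nonneg _) (by positivity)
      _ = |(a : ℝ)| * ((k + 2) / 2 * R) := by
          simp; ring
  exact le_of_mul_le_mul_left hmul hpos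

/-- A subgroup commensurable with the span of vectors of norm at most `R` has a basis of vectors
of norm at most `(k + 1) / 2 * R`, where `k` is its rank. -/
lemma exists_bounded_basis (R : ℝ) (S : Finset (A n)) (hSR : ∀ x ∈ S, euclNorm x ≤ R)
    (L : Submodule ℤ (A n)) (hSL : ∀ x ∈ S, x ∈ L)
    (hL : ∀ x ∈ L, ∃ a : ℤ, a ≠ 0 ∧ a • x ∈ Submodule.span ℤ (S : Set (A n))) :
    ∃ (k : ℕ) (f : Module.Basis (Fin k) ℤ L) (w : Fin k → A n),
      (∀ i, w i ∈ L) ∧ (∀ i, euclNorm (w i) ≤ R) ∧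
      (∀ x ∈ L, ∃ a : ℤ, a ≠ 0 ∧ a • x ∈ Submodule.span ℤ (Set.range w)) ∧
      ∀ i, euclNorm (f i : A n) ≤ (k + 1) / 2 * R := by
  classical
  -- The vectors `w` are carried along because reducing against them, rather than against the longer
  -- basis `f`, keeps the bound linear in k.
  induction S using Finset.induction_on generalizing L with
  | empty =>
    have hbot : L = ⊥ := by
      refine (Submodule.eq_bot_iff _).2 fun x hx => ?_
      obtain ⟨a, ha, hax⟩ := hL x hx
      have : a • x = 0 := by simpa using hax
      exact (smul_eq_zero.1 this).resolve_left ha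
    subst hbot
    refine ⟨0, Module.Basis.empty _, Fin.elim0, fun i => i.elim0, fun i => i.elim0,
      fun x hx => ⟨1, one_ne_zero, ?_⟩, fun i => i.elim0⟩
    rw [(Submodule.mem_bot ℤ).1 hx, smul_zero]
    exact Submodule.zero_mem _
  | insert v S hvS ih =>
    have hvR : euclNorm v ≤ R := hSR v (Finset.mem_insert_self _ _)
    have hvL : v ∈ L := hSL v (Finset.mem_insert_self _ _)
    have hSR' : ∀ x ∈ S, euclNorm x ≤ R := fun x hx => hSR x (Finset.mem_insert_of_mem hx)
    have hSL' : ∀ x ∈ S, x ∈ L := fun x hx => hSL x (Finset.mem_insert_of_mem hx)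
    rw [Finset.coe_insert] at hL
    by_cases hdep : ∃ a : ℤ, a ≠ 0 ∧ a • v ∈ Submodule.span ℤ (S : Set (A n))
    · refine ih hSR' L hSL' fun x hx => ?_
      obtain ⟨b, hb, hbv⟩ := hdep
      obtain ⟨a, ha, hax⟩ := hL x hx
      obtain ⟨z, s, hs, hzs⟩ := Submodule.mem_span_insert.1 hax
      refine ⟨b * a, mul_ne_zero hb ha, ?_⟩
      rw [mul_smul, hzs, smul_add, smul_comm b z v]
      exact Submodule.add_mem _ (Submodule.smul_mem _ _ hbv) (Submodule.smul_mem _ _ hs)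
    · push Not at hdep
      -- The kernel of `l` cuts `L` down to a subgroup commensurable with the span of `S`. Its basis
      -- is extended by an element `y` of `L` whose value generates `l(L)`.
      obtain ⟨l, hlS, hlv⟩ := exists_functional_ne_zero _ v hdep
      set N : Submodule ℤ (A n) := L ⊓ LinearMap.ker l with hN
      have hNL : N ≤ L := inf_le_left
      obtain ⟨k, f, w, hwN, hwR, hwsat, hf⟩ := ih hSR' N
        (fun x hx => ⟨hSL' x hx, hlS x (Submodule.subset_span hx)⟩) (by
          rintro x ⟨hxL, hxl⟩
          obtain ⟨a, ha, hax⟩ := hL x hxL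
          obtain ⟨z, s, hs, hzs⟩ := Submodule.mem_span_insert.1 hax
          have h1 := congrArg l hzs
          rw [map_smul, map_add, map_smul, hlS s hs, LinearMap.mem_ker.1 hxl] at h1
          have hz : z = 0 := by
            simpa [hlv] using h1
          refine ⟨a, ha, ?_⟩
          rw [hzs, hz, zero_smul, zero_add]
          exact hs)
      -- a generator of the image of `L` under `l`
      obtain ⟨d, hd⟩ := (IsPrincipalIdealRing.principal (L.map l : Submodule ℤ ℤ)).principal
      obtain ⟨y, hyL, hyd⟩ : d ∈ L.map l := by
        rw [hd]; exact Submodule.mem_span_singleton_self d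
      have hmult : ∀ x ∈ L, ∃ t : ℤ, l x = t * d := fun x hx => by
        have : l x ∈ L.map l := ⟨x, hx, rfl⟩
        rw [hd] at this
        obtain ⟨t, ht⟩ := Submodule.mem_span_singleton.1 this
        exact ⟨t, ht.symm⟩
      obtain ⟨t, ht⟩ := hmult v hvL
      have ht0 : t ≠ 0 := fun h => hlv (by rw [ht, h, zero_mul])
      have hd0 : d ≠ 0 := fun h => hlv (by rw [ht, h, mul_zero])
      -- Here t • y − v lies in ker l, so (m t) • y = m • v plus a combination of the `w j`, and |m|
      -- ≤ |m t|.
      obtain ⟨m, hm, hmw⟩ := hwsat (t • y - v)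
        ⟨L.sub_mem (L.smul_mem _ hyL) hvL, by
          rw [SetLike.mem_coe, LinearMap.mem_ker, map_sub, map_smul, hyd, ht, smul_eq_mul,
            sub_self]⟩
      obtain ⟨q, hq⟩ := (Submodule.mem_span_range_iff_exists_fun ℤ).1 hmw
      obtain ⟨z, hz, hyz⟩ := exists_size_reduction w y v (m * t) m q R (mul_ne_zero hm ht0)
        (by rw [abs_mul]; exact le_mul_of_one_le_right (abs_nonneg _) (Int.one_le_abs ht0))
        (by rw [hq, smul_sub, mul_smul]; abel) hvR hwR
      have hzN : z ∈ N := Submodule.span_le.2 (Set.range_subset_iff.2 hwN) hz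
      have hyL' : y - z ∈ L := L.sub_mem hyL (hNL hzN)
      have hld : l (y - z) = d := by
        rw [map_sub, LinearMap.mem_ker.1 hzN.2, hyd, sub_zero]
      refine ⟨k + 1, Module.Basis.mkFinConsOfLE (y - z) hyL' f hNL ?_ ?_, Fin.cons v w,
        ?_, ?_, ?_, ?_⟩
      · intro c x hx hcx
        have h1 := congrArg l hcx
        rw [map_add, map_smul, hld, LinearMap.mem_ker.1 hx.2, add_zero, map_zero] at h1
        simpa [hd0] using h1
      · intro x hx
        obtain ⟨c, hc⟩ := hmult x hx
        refine ⟨-c, L.add_mem hx (L.smul_mem _ hyL'), ?_⟩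
        rw [SetLike.mem_coe, LinearMap.mem_ker, map_add, map_smul, hld, hc]
        simp
      · exact Fin.cases hvL fun i => hNL (hwN i)
      · exact Fin.cases hvR fun i => hwR i
      · intro x hx
        -- This combination of `x` and `v` is annihilated by `l`.
        obtain ⟨a, ha, hax⟩ := hwsat (l v • x - l x • v)
          ⟨L.sub_mem (L.smul_mem _ hx) (L.smul_mem _ hvL), by
            rw [SetLike.mem_coe, LinearMap.mem_ker, map_sub, map_smul, map_smul, smul_eq_mul,
              smul_eq_mul, mul_comm, sub_self]⟩
        refine ⟨a * l v, mul_ne_zero ha hlv, ?_⟩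
        rw [Fin.range_cons, Submodule.mem_span_insert]
        exact ⟨a * l x, _, hax, by rw [smul_sub, mul_smul, mul_smul]; abel⟩
      · have hR : 0 ≤ R := (euclNorm_nonneg v).trans hvR
        intro i
        rw [Module.Basis.coe_mkFinConsOfLE]
        refine Fin.cases ?_ (fun j => ?_) i
        · simp only [Fin.cons_zero]
          push_cast
          linarith
        · simp only [Fin.cons_succ, Function.comp_apply, Submodule.coe_inclusion]
          refine (hf j).trans ?_
          push_cast
          nlinarith

end ReducedBasis

end ReducedSystem

namespace ReducedSystem

/-! ### The external square as skew-symmetric integer matrices -/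

section Wedge

variable {n : ℕ}

/-- The `(i, j)` entry of the skew-symmetric matrix of an element of `Λ²(A_n)`. -/
noncomputable def entry (i j : Fin n) : Wedge n →ₗ[ℤ] ℤ :=
  exteriorPower.pairingDual ℤ (A n) 2
    (exteriorPower.ιMulti ℤ 2 ![LinearMap.proj i, LinearMap.proj j])

lemma entry_wedge (i j : Fin n) (x y : A n) : entry i j (wedge x y) = x i * y j - x j * y i := by
  simp [entry, wedge, exteriorPower.pairingDual_ιMulti_ιMulti, Matrix.det_fin_two]

lemma repr_eq_entry (h : Wedge n) (s : Set.powersetCard (Fin n) 2) :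
    ((Pi.basisFun ℤ (Fin n)).exteriorPower 2).repr h s =
      entry (Set.powersetCard.ofFinEmbEquiv.symm s 0) (Set.powersetCard.ofFinEmbEquiv.symm s 1)
        h := by
  rw [exteriorPower.basis_repr_apply, exteriorPower.ιMultiDual, exteriorPower.ιMulti_family, entry]
  congr 3

lemma ext_entry {h h' : Wedge n} (H : ∀ i j, entry i j h = entry i j h') : h = h' := by
  refine ((Pi.basisFun ℤ (Fin n)).exteriorPower 2).repr.injective (Finsupp.ext fun s => ?_)
  rw [repr_eq_entry, repr_eq_entry, H]

lemma wedge_add (x y z : A n) : wedge x (y + z) = wedge x y + wedge x z :=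
  ext_entry fun i j => by simp only [map_add, entry_wedge, Pi.add_apply]; ring

lemma wedge_smul (x y : A n) (a : ℤ) : wedge x (a • y) = a • wedge x y :=
  ext_entry fun i j => by
    simp only [map_smul, entry_wedge, Pi.smul_apply, smul_eq_mul]; ring

lemma wedge_zero (x : A n) : wedge x 0 = 0 :=
  ext_entry fun i j => by simp [entry_wedge]

lemma entry_swap (h : Wedge n) (i j : Fin n) : entry i j h = - entry j i h := by
  have h1 : (entry i j + entry j i : Wedge n →ₗ[ℤ] ℤ) = 0 := by
    refine exteriorPower.linearMap_ext ?_
    ext v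
    have := entry_wedge i j (v 0) (v 1)
    have h2 := entry_wedge j i (v 0) (v 1)
    have hv : exteriorPower.ιMulti ℤ 2 v = wedge (v 0) (v 1) := by
      rw [wedge]; congr 1; ext k; fin_cases k <;> rfl
    simp only [LinearMap.compAlternatingMap_apply, LinearMap.add_apply, hv, this, h2]
    simp
  have := LinearMap.congr_fun h1 h
  simp only [LinearMap.add_apply, LinearMap.zero_apply] at this
  linarith

/-- The `j`-th column of the skew-symmetric matrix of `h`. -/
noncomputable def column (h : Wedge n) (j : Fin n) : A n := fun i => entry i j h

/-- The diagonal entry vanishes, and the other entries of the column are, up to sign, distinct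
coordinates of `h`. -/
lemma euclNorm_column_le (h : Wedge n) (j : Fin n) : euclNorm (column h j) ≤ wedgeNorm h := by
  refine Real.le_sqrt_of_sq_le ?_
  rw [euclNorm_sq]
  have hjj : entry j j h = 0 := by linarith [entry_swap h j j]
  let P : {i : Fin n // i ≠ j} → Set.powersetCard (Fin n) 2 := fun i =>
    ⟨{i.1, j}, by simpa using Finset.card_pair i.2⟩
  have hPinj : Function.Injective P := by
    intro a b hab
    have h1 : ({a.1, j} : Finset (Fin n)) = {b.1, j} := congrArg Subtype.val hab
    have h2 : a.1 ∈ ({b.1, j} : Finset (Fin n)) := h1 ▸ Finset.mem_insert_self _ _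
    rw [Finset.mem_insert, Finset.mem_singleton] at h2
    exact Subtype.ext (h2.resolve_right a.2)
  have hP (i : {i : Fin n // i ≠ j}) :
      ((column h j i.1 : ℤ) : ℝ) ^ 2 =
        ((((Pi.basisFun ℤ (Fin n)).exteriorPower 2).repr h (P i) : ℤ) : ℝ) ^ 2 := by
    rw [repr_eq_entry]
    set e := Set.powersetCard.ofFinEmbEquiv.symm (P i) with he
    have hmem (k : Fin 2) : e k = i.1 ∨ e k = j := by
      have : e k ∈ P i :=
        (Set.powersetCard.mem_range_ofFinEmbEquiv_symm_iff_mem (P i) (e k)).1 ⟨k, rfl⟩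
      have h2 : e k ∈ ({i.1, j} : Finset (Fin n)) := this
      simpa using h2
    have hne : e 0 ≠ e 1 := fun h => by simpa using e.injective h
    rcases hmem 0 with h0 | h0 <;> rcases hmem 1 with h1 | h1
    · exact absurd (h0.trans h1.symm) hne
    · rw [h0, h1, column]
    · rw [h0, h1, column, entry_swap h i.1 j]; push_cast; ring
    · exact absurd (h0.trans h1.symm) hne
  calc ∑ i, ((column h j i : ℤ) : ℝ) ^ 2
      = ∑ i : {i : Fin n // i ≠ j}, ((column h j i.1 : ℤ) : ℝ) ^ 2 := by
        rw [Fintype.sum_eq_add_sum_subtype_ne _ j]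
        simp [column, hjj]
    _ = ∑ i : {i : Fin n // i ≠ j},
        ((((Pi.basisFun ℤ (Fin n)).exteriorPower 2).repr h (P i) : ℤ) : ℝ) ^ 2 :=
        Finset.sum_congr rfl fun i _ => hP i
    _ ≤ _ := by
        rw [← Finset.sum_image (s := Finset.univ) (g := P)
          (f := fun s => ((((Pi.basisFun ℤ (Fin n)).exteriorPower 2).repr h s : ℤ) : ℝ) ^ 2)
          hPinj.injOn]
        exact Finset.sum_le_sum_of_subset_of_nonneg (Finset.subset_univ _)
          fun _ _ _ => sq_nonneg _

/-- The columns of a sum of wedge products. -/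
lemma column_sum_wedge {ι : Type*} [Fintype ι] (x y : ι → A n) (j : Fin n) :
    column (∑ k, wedge (x k) (y k)) j = ∑ k, (y k j • x k - x k j • y k) := by
  ext i
  simp only [column, map_sum, entry_wedge, Finset.sum_apply, Pi.sub_apply, Pi.smul_apply,
    smul_eq_mul]
  exact Finset.sum_congr rfl fun k _ => by ring

/-- Applying an endomorphism of `L` that fixes the columns of `∑ x k ∧ y k` to all factors does
not change this sum. -/
lemma sum_wedge_map_eq {ι : Type*} [Fintype ι] (L : Submodule ℤ (A n)) (p : L →ₗ[ℤ] L)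
    (x y : ι → L)
    (hp : ∀ z : L, (∃ j, (z : A n) = column (∑ k, wedge (x k : A n) (y k)) j) → p z = z) :
    ∑ k, wedge (p (x k) : A n) (p (y k)) = ∑ k, wedge (x k : A n) (y k) := by
  set h : Wedge n := ∑ k, wedge (x k : A n) (y k) with hh
  -- Apply `p` to the left factors of ∑ (x ⊗ y − y ⊗ x) only: every column is replaced by its image
  -- under `p`, so the matrix does not change.
  have hcol (j : Fin n) :
      ∑ k, ((y k : A n) j • (p (x k) : A n) - (x k : A n) j • (p (y k) : A n)) = column h j := by
    have hz : ((∑ k, ((y k : A n) j • x k - (x k : A n) j • y k) : L) : A n) = column h j := by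
      rw [hh, column_sum_wedge]; simp
    rw [← hz, ← hp _ ⟨j, hz⟩]
    simp [map_sum, map_sub, map_smul]
  -- Now apply `p` to the right factors. By `hcol` the rows are still those of `h`, which by
  -- skew-symmetry are negated columns and so are fixed as well.
  have hrow (i : Fin n) :
      ∑ k, ((p (x k) : A n) i • (p (y k) : A n) - (p (y k) : A n) i • (p (x k) : A n)) =
        - column h i := by
    have hz : ((-∑ k, ((p (x k) : A n) i • y k - (p (y k) : A n) i • x k) : L) : A n) =
        column h i := by
      ext j
      have h1 := congrFun (hcol j) i
      rw [column, entry_swap, ← show column h j i = entry i j h from rfl, ← h1]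
      simp only [NegMemClass.coe_neg, Submodule.coe_sum, Submodule.coe_sub, Submodule.coe_smul,
        Pi.neg_apply, Finset.sum_apply, Pi.sub_apply, Pi.smul_apply, smul_eq_mul]
      exact congrArg _ (Finset.sum_congr rfl fun k _ => by ring)
    rw [← hz, ← hp _ ⟨i, hz⟩]
    simp [map_sum, map_sub, map_smul]
  refine ext_entry fun i j => ?_
  have h1 := congrFun (hrow i) j
  rw [entry_swap h i j]
  simp only [Finset.sum_apply, Pi.sub_apply, Pi.smul_apply, smul_eq_mul, Pi.neg_apply, column]
    at h1
  rw [← h1, map_sum]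
  exact Finset.sum_congr rfl fun k _ => by rw [entry_wedge]; ring

/-- Linearity in the second factor collects one term for each `c i`, so that `h` becomes an honest
finite sum of wedges. -/
lemma mem_subK_iff {m : ℕ} (c : Fin m → A n) (L : Submodule ℤ (A n)) (w : Wedge n) :
    w ∈ subK c L ↔ ∃ x : Fin m → L, w = ∑ i, wedge (c i) (x i) := by
  classical
  constructor
  · intro hw
    induction hw using Submodule.span_induction with
    | mem w hw =>
      obtain ⟨i, x, hx, rfl⟩ := hw
      refine ⟨Pi.single i ⟨x, hx⟩, ?_⟩
      rw [Finset.sum_eq_single i]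
      · simp
      · intro j _ hj
        simp [hj, wedge_zero]
      · simp
    | zero => exact ⟨0, by simp [wedge_zero]⟩
    | add v w _ _ hv hw =>
      obtain ⟨x, rfl⟩ := hv
      obtain ⟨y, rfl⟩ := hw
      exact ⟨x + y, by simp [wedge_add, Finset.sum_add_distrib]⟩
    | smul a w _ hw =>
      obtain ⟨x, rfl⟩ := hw
      refine ⟨a • x, ?_⟩
      rw [Finset.smul_sum]
      exact Finset.sum_congr rfl fun i _ => (wedge_smul _ _ _).symm
  · rintro ⟨x, rfl⟩
    exact Submodule.sum_mem _ fun i _ => Submodule.subset_span ⟨i, x i, (x i).2, rfl⟩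

end Wedge

/-! ### Distances in the Cayley graph and chains modulo subgroups -/

section Graph

variable {n : ℕ}

lemma euclNorm_sub_le_walk_length {x y : A n} (w : (cayleyGraph n).Walk x y) :
    euclNorm (x - y) ≤ w.length := by
  induction w with
  | nil => simp
  | @cons a b d hab _ ih =>
    have h1 : euclNorm (a - b) ≤ 1 := by
      obtain ⟨-, g, ⟨i, rfl⟩, h | h⟩ := (SimpleGraph.addCayley_adj' _ a b).1 hab
      · rw [← h, euclNorm_sub_comm, add_sub_cancel_left, euclNorm_gen]
      · rw [h, add_sub_cancel_left, euclNorm_gen]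
    have h2 := euclNorm_add_le (a - b) (b - d)
    rw [sub_add_sub_cancel] at h2
    rw [SimpleGraph.Walk.length_cons]
    push_cast
    linarith

/-- Connectedness matters because `dist` takes the value 0 on unreachable pairs, which would ruin
the lower bound on distances. -/
lemma cayleyGraph_reachable (x y : A n) : (cayleyGraph n).Reachable x y := by
  let H : AddSubgroup (A n) :=
    { carrier := {z | ∀ x, (cayleyGraph n).Reachable x (x + z)}
      zero_mem' := fun x => by simp
      add_mem' := fun {a b} ha hb x => by
        rw [← add_assoc]; exact (ha x).trans (hb (x + a))
      neg_mem' := fun {a} ha x => by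
        have := (ha (x + -a)).symm
        rwa [neg_add_cancel_right] at this }
  have hgen (i : Fin n) : gen i ∈ H := fun x => by
    refine SimpleGraph.Adj.reachable ((SimpleGraph.addCayley_adj' _ _ _).2
      ⟨?_, gen i, ⟨i, rfl⟩, Or.inl rfl⟩)
    intro h
    have h0 : gen i = 0 := by simpa using h
    have := euclNorm_gen i
    rw [h0, euclNorm_zero] at this
    exact zero_ne_one this
  have hall (z : A n) : z ∈ H := by
    have : z = ∑ i, z i • gen i := by
      ext j
      simp [gen, Finset.sum_apply, Pi.single_apply]
    rw [this]
    exact sum_mem fun i _ => zsmul_mem (hgen i) _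
  have := hall (y - x) x
  rwa [add_sub_cancel] at this

lemma euclNorm_sub_le_dist (x y : A n) : euclNorm (x - y) ≤ (cayleyGraph n).dist x y := by
  obtain ⟨w, hw⟩ := (cayleyGraph_reachable x y).exists_walk_length_eq_dist
  rw [← hw]
  exact euclNorm_sub_le_walk_length w

/-- The translation between two edges with the same label is at most as long as their distance. -/
lemma euclNorm_sub_le_edgeDist (e f : Edge n) (hef : e.2 = f.2) :
    euclNorm (e.1 - f.1) ≤ edgeDist e f := by
  rw [edgeDist]
  split_ifs with h
  · simp [h]
  · have hg := euclNorm_gen f.2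
    have h1 := euclNorm_sub_le_dist e.1 f.1
    have h2 := euclNorm_sub_le_dist e.1 (f.1 + gen f.2)
    have h3 := euclNorm_sub_le_dist (e.1 + gen e.2) f.1
    have h4 := euclNorm_sub_le_dist (e.1 + gen e.2) (f.1 + gen f.2)
    rw [hef] at *
    -- For mismatched endpoints the error is one generator, of norm 1, absorbed by the two
    -- half-edges in `edgeDist`.
    have h2' := euclNorm_add_le (e.1 - (f.1 + gen f.2)) (gen f.2)
    have h3' := euclNorm_sub_le (e.1 + gen f.2 - f.1) (gen f.2)
    rw [show e.1 - (f.1 + gen f.2) + gen f.2 = e.1 - f.1 by abel] at h2'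
    rw [show e.1 + gen f.2 - f.1 - gen f.2 = e.1 - f.1 by abel] at h3'
    rw [add_sub_add_right_eq_sub] at h4
    push_cast
    have : euclNorm (e.1 - f.1) - 1 ≤
        min (min ((cayleyGraph n).dist e.1 f.1 : ℝ) ((cayleyGraph n).dist e.1 (f.1 + gen f.2)))
          (min ((cayleyGraph n).dist (e.1 + gen f.2) f.1 : ℝ)
            ((cayleyGraph n).dist (e.1 + gen f.2) (f.1 + gen f.2))) :=
      le_min (le_min (by linarith) (by linarith)) (le_min (by linarith) (by linarith))
    linarith

lemma edgeDist_le_diamSupp (δ : Chain n) {e f : Edge n} (he : e ∈ δ.support)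
    (hf : f ∈ δ.support) : edgeDist e f ≤ diamSupp δ :=
  Finset.le_sup (f := fun p : Edge n × Edge n => edgeDist p.1 p.2)
    (Finset.mk_mem_product he hf)

/-- A chain which vanishes modulo `L` vanishes modulo any subgroup of `L` which identifies the
same edges of its support. -/
lemma quotChain_eq_zero_of_le {L L' : Submodule ℤ (A n)} (hle : L' ≤ L) (δ : Chain n)
    (hδ : quotChain L δ = 0)
    (H : ∀ e ∈ δ.support, ∀ f ∈ δ.support, e.2 = f.2 → e.1 - f.1 ∈ L → e.1 - f.1 ∈ L') :
    quotChain L' δ = 0 := by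
  classical
  let q : QuotEdge L' → QuotEdge L := fun e => (Submodule.factor hle e.1, e.2)
  let π : Edge n → QuotEdge L' := fun e => (Submodule.Quotient.mk e.1, e.2)
  -- Passing from L' to L merges no further edges of the support, so no additional cancellation can
  -- occur.
  have hq : Set.InjOn q (π '' (δ.support : Set (Edge n))) := by
    rintro _ ⟨e, he, rfl⟩ _ ⟨f, hf, rfl⟩ hef
    have h1 : (Submodule.Quotient.mk e.1 : A n ⧸ L) = Submodule.Quotient.mk f.1 :=
      congrArg (fun e : QuotEdge L => e.1) hef
    have h2 : e.2 = f.2 := congrArg (fun e : QuotEdge L => e.2) hef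
    exact Prod.ext ((Submodule.Quotient.eq L').2
      (H e he f hf h2 ((Submodule.Quotient.eq L).1 h1))) h2
  have hcomp : Finsupp.mapDomain q (quotChain L' δ) = quotChain L δ := by
    rw [quotChain, ← Finsupp.mapDomain_comp]; rfl
  refine Finsupp.mapDomain_injOn (M := ℤ) _ hq (x₁ := quotChain L' δ) (x₂ := 0)
    ?_ ?_ ?_
  · intro a ha
    have := Finsupp.mapDomain_support ha
    simpa using this
  · simp
  · rw [hcomp, hδ, Finsupp.mapDomain_zero]

end Graph

/-! ### Comparison of constants -/

section Bound

variable {n : ℕ}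

lemma omega_pos : 0 < ω := by unfold ω; positivity

lemma omega_sq : ω ^ 2 = 3 / 4 := by
  rw [ω, div_pow, Real.sq_sqrt (by norm_num)]; norm_num

lemma omega_le_one : ω ≤ 1 := by nlinarith [omega_sq, omega_pos]

/-- The square of the inequality (k + 2)/2 ≤ 2 ω⁻ᵏ, as ω⁻² = 4/3. From k = 5 on, (k + 3)² ≤ (4/3)(k
+ 2)², so induction works; the smaller cases are numerical. -/
lemma sq_le_mul_four_thirds_pow (k : ℕ) : ((k : ℝ) + 2) ^ 2 ≤ 16 * (4 / 3) ^ k := by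
  rcases Nat.lt_or_ge k 5 with h | h
  · interval_cases k <;> norm_num
  · induction k, h using Nat.le_induction with
    | base => norm_num
    | succ k hk ih =>
      have hk' : (5 : ℝ) ≤ k := by exact_mod_cast hk
      rw [pow_succ (4 / 3 : ℝ)]
      push_cast
      nlinarith

lemma succ_div_two_le_omega_zpow (k : ℕ) :
    ((k : ℝ) + 2) / 2 ≤ 2 * ω ^ (1 - ((k + 1 : ℕ) : ℤ)) := by
  have hz : ω ^ (1 - ((k + 1 : ℕ) : ℤ)) = (ω⁻¹) ^ k := by
    rw [show (1 - ((k + 1 : ℕ) : ℤ)) = -(k : ℤ) by push_cast; ring, zpow_neg, zpow_natCast, inv_pow]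
  rw [hz]
  have hpos : 0 ≤ (ω⁻¹) ^ k := pow_nonneg (inv_nonneg.2 omega_pos.le) _
  have hsq : ((ω⁻¹) ^ k) ^ 2 = (4 / 3) ^ k := by
    rw [← pow_mul, mul_comm, pow_mul, inv_pow, omega_sq]; norm_num
  refine abs_le_of_sq_le_sq' ?_ (by positivity) |>.2
  have := sq_le_mul_four_thirds_pow k
  rw [mul_pow, hsq, div_pow]
  linarith

lemma wedgeNorm_nonneg (h : Wedge n) : 0 ≤ wedgeNorm h := Real.sqrt_nonneg _

lemma euclNorm_le_maxNorm {m : ℕ} (c : Fin m → A n) (i : Fin m) : euclNorm (c i) ≤ maxNorm c :=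
  le_ciSup (f := fun i => euclNorm (c i)) (Set.finite_range _).bddAbove i

lemma maxNorm_nonneg {m : ℕ} (c : Fin m → A n) : 0 ≤ maxNorm c :=
  Real.iSup_nonneg fun _ => euclNorm_nonneg _

lemma maxNorm_eq_zero_or_one_le {m : ℕ} (c : Fin m → A n) : maxNorm c = 0 ∨ 1 ≤ maxNorm c := by
  by_cases hc : ∀ i, c i = 0
  · left
    simp [maxNorm, hc]
  · right
    push Not at hc
    obtain ⟨i, hi⟩ := hc
    exact (one_le_euclNorm hi).trans (euclNorm_le_maxNorm c i)

/-- Excludes 0 < D < 1, where D ≤ Dⁿ could fail. -/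
lemma constD_eq_zero_or_one_le {m : ℕ} (c : Fin m → A n) (δ : Chain n) :
    constD c δ = 0 ∨ 1 ≤ constD c δ := by
  rw [constD]
  rcases maxNorm_eq_zero_or_one_le c with h | h
  · rw [h, zero_add]
    rcases Nat.eq_zero_or_pos (diamSupp δ) with h' | h'
    · left; simp [h']
    · right; exact_mod_cast h'
  · right
    have : (0 : ℝ) ≤ diamSupp δ := Nat.cast_nonneg _
    linarith

lemma constD_nonneg {m : ℕ} (c : Fin m → A n) (δ : Chain n) : 0 ≤ constD c δ :=
  add_nonneg (maxNorm_nonneg c) (Nat.cast_nonneg _)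

/-- Each of the two summands of the bound dominates one argument of the maximum: the first through
(n + 1)/2 ≤ n and D ≤ Dⁿ, the second through (n + 1)/2 ≤ 2 ω¹⁻ⁿ. -/
lemma mul_max_le_basisBound {m : ℕ} (hn : 0 < n) (c : Fin m → A n) (δ : Chain n) (h : Wedge n) :
    ((n : ℝ) + 1) / 2 * max (constD c δ) (wedgeNorm h) ≤ basisBound c δ h := by
  have hD := constD_nonneg c δ
  have hh := wedgeNorm_nonneg h
  have h1 : ((n : ℝ) + 1) / 2 * constD c δ ≤
      n * 2 ^ n * ω ^ (-((n : ℤ) * (n - 1) / 2)) * constD c δ ^ n := by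
    have hn1 : (1 : ℝ) ≤ n := by exact_mod_cast hn
    have hω : 1 ≤ ω ^ (-((n : ℤ) * (n - 1) / 2)) := by
      refine one_le_zpow_of_nonpos₀ omega_pos omega_le_one ?_
      have : (0 : ℤ) ≤ (n : ℤ) * (n - 1) / 2 :=
        Int.ediv_nonneg (mul_nonneg (by omega) (by omega)) (by norm_num)
      omega
    have hp : (1 : ℝ) ≤ 2 ^ n := one_le_pow₀ (by norm_num)
    have hDn : constD c δ ≤ constD c δ ^ n := by
      rcases constD_eq_zero_or_one_le c δ with h0 | h0
      · rw [h0, zero_pow hn.ne']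
      · exact le_self_pow₀ h0 hn.ne'
    have hc : ((n : ℝ) + 1) / 2 ≤ n * 2 ^ n * ω ^ (-((n : ℤ) * (n - 1) / 2)) :=
      calc ((n : ℝ) + 1) / 2 ≤ n * 1 * 1 := by linarith
        _ ≤ _ := by gcongr
    exact mul_le_mul hc hDn hD (by linarith)
  have h2 : ((n : ℝ) + 1) / 2 * wedgeNorm h ≤
      2 * ω ^ (1 - (n : ℤ)) * wedgeNorm h * (max 1 (maxNorm c)) ^ n := by
    obtain ⟨k, rfl⟩ : ∃ k, n = k + 1 := ⟨n - 1, by omega⟩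
    have hk := succ_div_two_le_omega_zpow k
    have hM : 1 ≤ (max 1 (maxNorm c)) ^ (k + 1) := one_le_pow₀ (le_max_left _ _)
    have h3 : 0 ≤ 2 * ω ^ (1 - ((k + 1 : ℕ) : ℤ)) * wedgeNorm h :=
      mul_nonneg (mul_nonneg (by norm_num) (zpow_nonneg omega_pos.le _)) hh
    refine le_trans ?_ (le_mul_of_one_le_right h3 hM)
    refine mul_le_mul_of_nonneg_right ?_ hh
    push_cast at hk ⊢
    linarith
  have hn2 : (0 : ℝ) ≤ ((n : ℝ) + 1) / 2 := by positivity
  rw [basisBound]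
  rcases max_cases (constD c δ) (wedgeNorm h) with ⟨h3, -⟩ | ⟨h3, -⟩ <;> rw [h3]
  · linarith [mul_nonneg hn2 hh]
  · linarith [mul_nonneg hn2 hD]

end Bound

end ReducedSystem

/-! ### Pushing a solution forward along a retraction -/

namespace ReducedSystem

variable {n g m : ℕ} {c : Fin m → A n} {δ : Chain n} {h : Wedge n}
  {u v : Fin g → A n} {L : Submodule ℤ (A n)}

/-- The short elements of `L` which a retraction of `L` has to fix in order to map solutions of
the system to solutions. -/
def shortElements (c : Fin m → A n) (δ : Chain n) (h : Wedge n) (L : Submodule ℤ (A n)) :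
    Set (A n) :=
  Set.range c ∪ Set.range (column h) ∪
    {z | z ∈ L ∧ ∃ e ∈ δ.support, ∃ f ∈ δ.support, e.2 = f.2 ∧ z = e.1 - f.1}

lemma euclNorm_le_of_mem_shortElements {z : A n} (hz : z ∈ shortElements c δ h L) :
    euclNorm z ≤ max (constD c δ) (wedgeNorm h) := by
  have hdiam : (0 : ℝ) ≤ diamSupp δ := Nat.cast_nonneg _
  rcases hz with (⟨i, rfl⟩ | ⟨j, rfl⟩) | ⟨-, e, he, f, hf, hef, rfl⟩
  · refine le_max_of_le_left ((euclNorm_le_maxNorm c i).trans ?_)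
    rw [constD]; linarith
  · exact le_max_of_le_right (euclNorm_column_le h j)
  · refine le_max_of_le_left ((euclNorm_sub_le_edgeDist e f hef).trans ?_)
    have h1 : (edgeDist e f : ℝ) ≤ diamSupp δ := by exact_mod_cast edgeDist_le_diamSupp δ he hf
    rw [constD]; linarith [maxNorm_nonneg c]

namespace IsSolution

lemma u_mem (hs : IsSolution c δ h u v L) (i : Fin g) : u i ∈ L :=
  hs.span_eq ▸ Submodule.subset_span (Or.inl (Or.inl ⟨i, rfl⟩))

lemma v_mem (hs : IsSolution c δ h u v L) (i : Fin g) : v i ∈ L :=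
  hs.span_eq ▸ Submodule.subset_span (Or.inl (Or.inr ⟨i, rfl⟩))

lemma c_mem (hs : IsSolution c δ h u v L) (i : Fin m) : c i ∈ L :=
  hs.span_eq ▸ Submodule.subset_span (Or.inr ⟨i, rfl⟩)

/-- In a solution, `h` is a sum of wedge products of elements of `L`. -/
lemma exists_eq_sum (hs : IsSolution c δ h u v L) :
    ∃ x : Fin m → L, h = ∑ i, wedge (u i) (v i) + ∑ i, wedge (c i) (x i) := by
  have h1 := (Submodule.Quotient.eq _).1 hs.wedge_eq.symm
  obtain ⟨x, hx⟩ := (mem_subK_iff c L _).1 h1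
  exact ⟨x, by rw [← hx]; abel⟩

/-- Only the columns need an argument: those of a sum of wedges are integral combinations of the
factors, here elements of `L`. -/
lemma shortElements_subset (hs : IsSolution c δ h u v L) : shortElements c δ h L ⊆ L := by
  rintro z ((⟨i, rfl⟩ | ⟨j, rfl⟩) | ⟨hz, -⟩)
  · exact hs.c_mem i
  · obtain ⟨x, hx⟩ := hs.exists_eq_sum
    have h1 : h = ∑ k : Fin g ⊕ Fin m,
        wedge (Sum.elim u c k) (Sum.elim v (fun i => (x i : A n)) k) := by
      rw [Fintype.sum_sum_type]; exact hx
    rw [h1, column_sum_wedge]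
    refine L.sum_mem fun k _ => L.sub_mem (L.smul_mem _ ?_) (L.smul_mem _ ?_)
    · rcases k with i | i
      exacts [hs.u_mem i, hs.c_mem i]
    · rcases k with i | i
      exacts [hs.v_mem i, (x i).2]
  · exact hz

/-- An endomorphism of `L` fixing the short elements maps solutions to solutions. -/
lemma map (hs : IsSolution c δ h u v L) (p : L →ₗ[ℤ] L)
    (hp : ∀ z : L, (z : A n) ∈ shortElements c δ h L → p z = z) :
    IsSolution c δ h (fun i => (p ⟨u i, hs.u_mem i⟩ : A n)) (fun i => (p ⟨v i, hs.v_mem i⟩ : A n))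
      ((LinearMap.range p).map L.subtype) := by
  have hpc (i : Fin m) : p ⟨c i, hs.c_mem i⟩ = ⟨c i, hs.c_mem i⟩ :=
    hp _ (Or.inl (Or.inl ⟨i, rfl⟩))
  have hmem (z : L) : (p z : A n) ∈ (LinearMap.range p).map L.subtype := ⟨p z, ⟨z, rfl⟩, rfl⟩
  refine ⟨le_antisymm ?_ ?_, ?_, ?_⟩
  · rw [Submodule.span_le]
    rintro z ((⟨i, rfl⟩ | ⟨i, rfl⟩) | ⟨i, rfl⟩)
    · exact hmem _
    · exact hmem _
    · have := hmem ⟨c i, hs.c_mem i⟩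
      rwa [hpc] at this
  · rintro _ ⟨_, ⟨⟨z, hz⟩, rfl⟩, rfl⟩
    rw [Submodule.subtype_apply]
    have hz' := hz
    rw [← hs.span_eq] at hz'
    induction hz' using Submodule.span_induction with
    | mem z hz' =>
      rcases hz' with (⟨i, rfl⟩ | ⟨i, rfl⟩) | ⟨i, rfl⟩
      · exact Submodule.subset_span (Or.inl (Or.inl ⟨i, rfl⟩))
      · exact Submodule.subset_span (Or.inl (Or.inr ⟨i, rfl⟩))
      · rw [hpc]
        exact Submodule.subset_span (Or.inr ⟨i, rfl⟩)
    | zero =>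
      have : p ⟨0, hz⟩ = 0 := map_zero p
      rw [this]
      exact Submodule.zero_mem _
    | add a b ha hb iha ihb =>
      rw [hs.span_eq] at ha hb
      have : p ⟨a + b, hz⟩ = p ⟨a, ha⟩ + p ⟨b, hb⟩ := map_add p ⟨a, ha⟩ ⟨b, hb⟩
      rw [this]
      exact Submodule.add_mem _ (iha ha) (ihb hb)
    | smul t a ha iha =>
      rw [hs.span_eq] at ha
      have : p ⟨t • a, hz⟩ = t • p ⟨a, ha⟩ := map_smul p t ⟨a, ha⟩
      rw [this]
      exact Submodule.smul_mem _ _ (iha ha)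
  -- Edges of the support identified modulo `L` differ by a short element, which `p` fixes and which
  -- therefore lies in the image.
  · refine quotChain_eq_zero_of_le (Submodule.map_subtype_le L _) δ hs.chain_eq
      fun e he f hf hef hL => ?_
    have := hmem ⟨e.1 - f.1, hL⟩
    rwa [hp _ (Or.inr ⟨hL, e, he, f, hf, hef, rfl⟩)] at this
  -- Since `p` fixes `h` and the `c i`, h = ∑ p(u)∧p(v) + ∑ c∧p(x), and the last sum lies in the new
  -- `K`.
  · obtain ⟨x, hx⟩ := hs.exists_eq_sum
    have hsum := sum_wedge_map_eq L p
      (Sum.elim (fun i => ⟨u i, hs.u_mem i⟩) (fun i => ⟨c i, hs.c_mem i⟩) : Fin g ⊕ Fin m → L)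
      (Sum.elim (fun i => ⟨v i, hs.v_mem i⟩) x) (by
        rintro z ⟨j, hz⟩
        refine hp z (Or.inl (Or.inr ⟨j, ?_⟩))
        rw [hz, Fintype.sum_sum_type]
        exact congrArg (column · j) hx)
    simp only [Fintype.sum_sum_type, Sum.elim_inl, Sum.elim_inr, hpc, ← hx] at hsum
    rw [eq_comm, Submodule.Quotient.eq, mem_subK_iff]
    exact ⟨fun i => ⟨p (x i), hmem _⟩, sub_eq_of_eq_add' hsum.symm⟩

end IsSolution

lemma shortElements_finite (c : Fin m → A n) (δ : Chain n) (h : Wedge n)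
    (L : Submodule ℤ (A n)) : (shortElements c δ h L).Finite :=
  (finite_ball n _).subset fun _ hz => euclNorm_le_of_mem_shortElements hz

/-- A subgroup commensurable with the span of its short elements has a bounded basis. -/
lemma hasBasisBoundedBy_of_shortElements (L₀ : Submodule ℤ (A n))
    (hL : shortElements c δ h L ⊆ L₀)
    (hsat : ∀ x ∈ L₀, ∃ a : ℤ, a ≠ 0 ∧ a • x ∈ Submodule.span ℤ (shortElements c δ h L)) :
    HasBasisBoundedBy L₀ (basisBound c δ h) := by
  have hfin := shortElements_finite c δ h L
  obtain ⟨k, f, -, -, -, -, hf⟩ := exists_bounded_basis (max (constD c δ) (wedgeNorm h))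
    hfin.toFinset (fun x hx => euclNorm_le_of_mem_shortElements (hfin.mem_toFinset.1 hx)) L₀
    (fun x hx => hL (hfin.mem_toFinset.1 hx)) (by rwa [hfin.coe_toFinset])
  refine ⟨k, f, fun i => (hf i).trans ?_⟩
  have hkn : k ≤ n := by
    have h1 := Submodule.finrank_le L₀
    rwa [Module.finrank_eq_card_basis f, Fintype.card_fin, Module.finrank_fin_fun] at h1
  -- A basis vector `i` exists, so the rank is positive.
  have hn : 0 < n := lt_of_lt_of_le (Fin.pos i) hkn
  refine le_trans ?_ (mul_max_le_basisBound hn c δ h)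
  have : (k : ℝ) ≤ n := by exact_mod_cast hkn
  have hR : 0 ≤ max (constD c δ) (wedgeNorm h) := le_max_of_le_right (wedgeNorm_nonneg h)
  gcongr

end ReducedSystem

theorem proposition3p5 {n g m : ℕ} (c : Fin m → ReducedSystem.A n) (δ : ReducedSystem.Chain n)
    (h : ReducedSystem.Wedge n) :
    ((∃ (u v : Fin g → ReducedSystem.A n) (L : Submodule ℤ (ReducedSystem.A n)),
        ReducedSystem.IsSolution c δ h u v L) →
      ∃ (u v : Fin g → ReducedSystem.A n) (L : Submodule ℤ (ReducedSystem.A n)),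
        ReducedSystem.IsSolution c δ h u v L ∧
        ReducedSystem.HasBasisBoundedBy L (ReducedSystem.basisBound c δ h)) ∧
    {L : Submodule ℤ (ReducedSystem.A n) |
        ReducedSystem.HasBasisBoundedBy L (ReducedSystem.basisBound c δ h)}.Finite := by
  refine ⟨?_, ReducedSystem.finite_hasBasisBoundedBy n _⟩
  rintro ⟨u, v, L, hs⟩
  -- The retraction is taken inside `L`, so the new subgroup is a subgroup of `L`.
  obtain ⟨p, hpS, hsat⟩ := ReducedSystem.exists_retraction
    (L.subtype ⁻¹' ReducedSystem.shortElements c δ h L)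
  refine ⟨_, _, _, hs.map p hpS, ReducedSystem.hasBasisBoundedBy_of_shortElements (L := L) _ ?_ ?_⟩
  · intro z hz
    exact ⟨⟨z, hs.shortElements_subset hz⟩, ⟨_, hpS _ hz⟩, rfl⟩
  · rintro _ ⟨_, ⟨x, rfl⟩, rfl⟩
    obtain ⟨a, ha, hax⟩ := hsat x
    refine ⟨a, ha, ?_⟩
    have h1 := Submodule.mem_map_of_mem (f := L.subtype) hax
    rw [Submodule.map_span, map_smul] at h1
    exact Submodule.span_mono (Set.image_preimage_subset _ _) h1
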